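/- **Proposition 3.4.** Let $\mathcal E$ be a separable real Banach space and $\mathcal H\subset\mathcal E$ an abstract Wiener space: $\mathcal H$ is a real Hilbert space, continuously (and injectively) included in $\mathcal E$ by $\iota$, and $\mu$ is a centred Gaussian measure on $\mathcal E$ with Cameron–Martin space $\mathcal H$, that is, $$\int_{\mathcal E} f(x)\,g(x)\,\mu(dx)=\langle \iota^*f,\iota^*g\rangle_{\mathcal H}\qquad\text{for all } f,g\in\mathcal E^*,$$ where $\iota^* f\in\mathcal H$ denotes the Riesz representative of $f\circ\iota$. (Density of $\mathcal H$ in $\mathcal E$ is not required.) Let $B,\tilde B$ be independent $\mathcal E$-valued random variables, both with law $\mu$, defined on a common probability space. Let $K^\delta:\mathcal E\times\mathcal E\to\mathbf R$, $\delta>0$, be continuous bilinear maps such that the limit $\tilde K=\lim_{\delta\to0}K^\delta(B,\tilde B)$ exists in $L^2$. Then $K^\delta(B,B)$ is integrable for every $\delta>0$, and the limit $$K=\lim_{\delta\to0}\bigl(K^\delta(B,B)-\mathbf E K^\delta(B,B)\bigr)$$ exists in $L^2$. Furthermore, $K$ depends only on $\tilde K$ and not on the approximating family: if $L^\delta:\mathcal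 E\times\mathcal E\to\mathbf R$, $\delta>0$, are any continuous bilinear maps with $L^\delta(B,\tilde B)\to\tilde K$ in $L^2$ as $\delta\to0$, then $L^\delta(B,B)-\mathbf E L^\delta(B,B)\to K$ in $L^2$. Finally, $\mathbf E K^2\le 2\,\mathbf E\tilde K^2$. -/

import Mathlib

open MeasureTheory ProbabilityTheory Filter Topology

/-- `μ` is a centred Gaussian measure on `E` whose Cameron–Martin space is the Hilbert space `H`,
included into `E` by the continuous injection `ι`: the covariance of `μ` is `ι ∘ ι*`, that is,
`∫ f(x) g(x) dμ(x) = ⟪ι* f, ι* g⟫_H` for all continuous linear functionals `f`, `g` on `E`. Here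
`ι* f` is the Riesz representative in `H` of the restriction `f ∘ ι` of `f` to `H`.

This says that `(ι, H, E)` is an abstract Wiener space with Wiener measure `μ`. Density of `ι H`
in `E`, which some authors require, is not imposed. -/
structure IsAbstractWienerSpace {H E : Type*}
    [NormedAddCommGroup H] [InnerProductSpace ℝ H] [CompleteSpace H]
    [NormedAddCommGroup E] [NormedSpace ℝ E] [MeasurableSpace E]
    (ι : H →L[ℝ] E) (μ : Measure E) : Prop where
  injective : Function.Injective ι
  isGaussian : IsGaussian μ
  centred : ∀ f : StrongDual ℝ E, ∫ x, f x ∂μ = 0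
  covariance : ∀ f g : StrongDual ℝ E,
    ∫ x, f x * g x ∂μ =
      inner ℝ ((InnerProductSpace.toDual ℝ H).symm (f.comp ι))
        ((InnerProductSpace.toDual ℝ H).symm (g.comp ι))

/-- The family of real random variables `X δ`, `δ > 0`, converges to `Y` in `L²(P)` as `δ → 0`. -/
def TendstoInL2 {Ω : Type*} [MeasurableSpace Ω] (P : Measure Ω) (X : ℝ → Ω → ℝ) (Y : Ω → ℝ) :
    Prop :=
  (∀ᶠ δ in 𝓝[>] (0 : ℝ), MemLp (X δ) 2 P) ∧ MemLp Y 2 P ∧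
    Tendsto (fun δ => eLpNorm (fun ω => X δ ω - Y ω) 2 P) (𝓝[>] (0 : ℝ)) (𝓝 0)

/-! For symmetric S and independent x, y with law μ, rotating (x, y) by π/4 shows that S(x, y) has
the law of (S(y, y) - S(x, x))/2, so Var S(x, x) = 2 E S(x, y)². Symmetrising a general form reduces
to this case at the price of an inequality (`variance_diag_le`). Thus K(B, B') ↦ K(B, B) - E K(B, B)
is linear and √2-Lipschitz for the L² norms, and existence, uniqueness and the norm bound all pass
to the limit (`exists_tendsto_of_norm_sub_le`). -/

/-- If `A` is controlled by `B` up to a constant, then convergence of `B ∘ K` along a filter forces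
convergence of `A ∘ K`, to a limit that is determined by the limit of `B ∘ K`. -/
lemma exists_tendsto_of_norm_sub_le {V F G α : Type*} [NormedAddCommGroup F] [CompleteSpace F]
    [NormedAddCommGroup G] {l : Filter α} [l.NeBot] {A : V → F} {B : V → G} {c : ℝ}
    (hAB : ∀ v w, ‖A v - A w‖ ≤ c * ‖B v - B w‖) (hle : ∀ v, ‖A v‖ ≤ c * ‖B v‖)
    {K : α → V} {k : G} (hK : Tendsto (fun i => B (K i)) l (𝓝 k)) :
    ∃ a : F, Tendsto (fun i => A (K i)) l (𝓝 a) ∧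
      (∀ L : α → V, Tendsto (fun i => B (L i)) l (𝓝 k) → Tendsto (fun i => A (L i)) l (𝓝 a)) ∧
      ‖a‖ ≤ c * ‖k‖ := by
  have hcauchy : Cauchy (l.map fun i => A (K i)) := by
    rw [cauchy_map_iff, Metric.uniformity_eq_comap_nhds_zero, tendsto_comap_iff]
    refine ⟨inferInstance, ?_⟩
    have h1 : Tendsto (fun p : α × α => c * ‖B (K p.1) - B (K p.2)‖) (l ×ˢ l) (𝓝 0) := by
      simpa using (((hK.comp tendsto_fst).sub (hK.comp tendsto_snd)).norm).const_mul c
    refine squeeze_zero (fun p => dist_nonneg) (fun p => ?_) h1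
    simpa [dist_eq_norm] using hAB (K p.1) (K p.2)
  obtain ⟨a, ha⟩ := CompleteSpace.complete hcauchy
  have ha : Tendsto (fun i => A (K i)) l (𝓝 a) := ha
  refine ⟨a, ha, fun L hL => ?_, le_of_tendsto_of_tendsto' ha.norm (hK.norm.const_mul c)
    fun i => hle _⟩
  have h1 : Tendsto (fun i => c * ‖B (L i) - B (K i)‖) l (𝓝 0) := by
    simpa using (hL.sub hK).norm.const_mul c
  simpa using (squeeze_zero_norm (fun i => hAB (L i) (K i)) h1).add ha

lemma tendstoInL2_iff {Ω : Type*} [MeasurableSpace Ω] {P : Measure Ω} {X : ℝ → Ω → ℝ} {Y : Ω → ℝ}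
    (hX : ∀ δ, MemLp (X δ) 2 P) (hY : MemLp Y 2 P) :
    TendstoInL2 P X Y ↔
      Tendsto (fun δ => (hX δ).toLp (X δ)) (𝓝[>] (0 : ℝ)) (𝓝 (hY.toLp Y)) := by
  rw [Lp.tendsto_Lp_iff_tendsto_eLpNorm'' X hX Y hY]
  exact ⟨fun h => h.2.2, fun h => ⟨.of_forall hX, hY, h⟩⟩

lemma norm_toLp_two_sq {Ω : Type*} [MeasurableSpace Ω] {P : Measure Ω} {X : Ω → ℝ}
    (hX : MemLp X 2 P) : ‖hX.toLp X‖ ^ 2 = ∫ ω, X ω ^ 2 ∂P := by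
  rw [← real_inner_self_eq_norm_sq, L2.inner_def]
  refine integral_congr_ae ?_
  filter_upwards [hX.coeFn_toLp] with ω h
  simp [h, sq]

section Gaussian

variable {E : Type*} [NormedAddCommGroup E] [NormedSpace ℝ E]

/-- Hölder with 1/4 + 1/4 = 1/2; Gaussian variables have finite fourth moments, so this covers both
diagonal and off-diagonal terms. -/
lemma memLp_two_bilin_comp {Ω : Type*} [MeasurableSpace Ω] {P : Measure Ω} {X Y : Ω → E}
    (hX : MemLp X 4 P) (hY : MemLp Y 4 P) (K : E →L[ℝ] E →L[ℝ] ℝ) :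
    MemLp (fun ω => K (X ω) (Y ω)) 2 P := by
  have : ENNReal.HolderTriple 4 4 2 := ⟨by
    rw [← ENNReal.toReal_eq_toReal_iff' (by simp) (by simp), ENNReal.toReal_add (by simp) (by simp)]
    norm_num [ENNReal.toReal_inv]⟩
  refine MemLp.of_bilin (fun x y => K x y) ‖K‖₊ hX hY
    (K.aestronglyMeasurable_comp₂ hX.1 hY.1) (.of_forall fun ω => ?_)
  exact_mod_cast K.le_opNorm₂ (X ω) (Y ω)

variable [CompleteSpace E] [SecondCountableTopology E] [MeasurableSpace E] [BorelSpace E]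
  {μ : Measure E}

/-- For a symmetric continuous bilinear form, rotation invariance of `μ.prod μ` relates the second
moment of the off-diagonal variable to the variance of the diagonal one. -/
lemma variance_diag_eq_of_symm [IsGaussian μ] (hμ : ∀ f : StrongDual ℝ E, ∫ x, f x ∂μ = 0)
    (S : E →L[ℝ] E →L[ℝ] ℝ) (hS : ∀ x y, S x y = S y x) :
    Var[fun x => S x x; μ] = 2 * ∫ p : E × E, S p.1 p.2 ^ 2 ∂(μ.prod μ) := by
  have hid : MemLp (fun x : E => x) 4 μ := IsGaussian.memLp_id μ 4 (by simp)
  have hq : MemLp (fun x => S x x) 2 μ := memLp_two_bilin_comp hid hid S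
  have hmp : MeasurePreserving (ContinuousLinearMap.rotation (E := E) (Real.pi / 4))
      (μ.prod μ) (μ.prod μ) :=
    ⟨by fun_prop, IsGaussian.map_rotation_eq_self_of_forall_strongDual_eq_zero hμ _⟩
  -- At angle π/4 the cross terms cancel by symmetry of `S`.
  have hrot (p : E × E) : S (ContinuousLinearMap.rotation (Real.pi / 4) p).1
      (ContinuousLinearMap.rotation (Real.pi / 4) p).2
      = (-2⁻¹) * S p.1 p.1 + 2⁻¹ * S p.2 p.2 := by
    have h2 : √2 * √2 = (2 : ℝ) := Real.mul_self_sqrt (by norm_num)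
    simp only [ContinuousLinearMap.rotation_apply, Real.cos_pi_div_four, Real.sin_pi_div_four,
      map_add, map_smul, add_apply, smul_apply, smul_eq_mul, hS p.2 p.1]
    linear_combination (-(S p.1 p.1) / 4 + S p.2 p.2 / 4) * h2
  have hX := hq.const_mul (-2⁻¹)
  have hY := hq.const_mul 2⁻¹
  have hmean : ∫ p : E × E, ((-2⁻¹) * S p.1 p.1 + 2⁻¹ * S p.2 p.2) ∂(μ.prod μ) = 0 := by
    rw [integral_add ((hX.comp_fst μ).integrable (by norm_num))
      ((hY.comp_snd μ).integrable (by norm_num)), integral_const_mul, integral_const_mul,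
      integral_fun_fst (f := fun x => S x x), integral_fun_snd (f := fun x => S x x)]
    simp
  have hint : ∫ p : E × E, S p.1 p.2 ^ 2 ∂(μ.prod μ)
      = ∫ p : E × E, ((-2⁻¹) * S p.1 p.1 + 2⁻¹ * S p.2 p.2) ^ 2 ∂(μ.prod μ) := by
    conv_lhs => rw [← hmp.map_eq]
    rw [integral_map (by fun_prop)
      (Continuous.aestronglyMeasurable (by fun_prop))]
    simp_rw [hrot]
  -- The two summands are independent, so the variances add: 1/4 + 1/4 = 1/2.
  rw [hint, ← variance_of_integral_eq_zero ?_ hmean, variance_add_prod hX hY,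
    variance_const_mul, variance_const_mul]
  · ring
  · exact ((hX.comp_fst μ).add (hY.comp_snd μ)).aemeasurable

/-- The variance of a continuous quadratic form under a centred Gaussian measure is at most twice
the second moment of the decoupled form. -/
lemma variance_diag_le [IsGaussian μ] (hμ : ∀ f : StrongDual ℝ E, ∫ x, f x ∂μ = 0)
    (K : E →L[ℝ] E →L[ℝ] ℝ) :
    Var[fun x => K x x; μ] ≤ 2 * ∫ p : E × E, K p.1 p.2 ^ 2 ∂(μ.prod μ) := by
  have hid : MemLp (fun x : E => x) 4 μ := IsGaussian.memLp_id μ 4 (by simp)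
  have hoff (T : E →L[ℝ] E →L[ℝ] ℝ) :
      Integrable (fun p : E × E => T p.1 p.2 ^ 2) (μ.prod μ) :=
    (memLp_two_bilin_comp (hid.comp_fst μ) (hid.comp_snd μ) T).integrable_sq
  -- Symmetrising leaves the diagonal unchanged; by convexity of the square and exchangeability of
  -- the coordinates, it does not increase the off-diagonal second moment.
  set S : E →L[ℝ] E →L[ℝ] ℝ := (2⁻¹ : ℝ) • (K + K.flip) with hSdef
  have hS (x y : E) : S x y = 2⁻¹ * (K x y + K y x) := by
    simp [hSdef, mul_add]
  have hdiag : (fun x => K x x) = fun x => S x x := by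
    ext x; rw [hS]; ring
  rw [hdiag, variance_diag_eq_of_symm hμ S fun x y => by rw [hS, hS, add_comm]]
  have hflip : Integrable (fun p : E × E => K p.2 p.1 ^ 2) (μ.prod μ) := hoff K.flip
  have hswap : ∫ p : E × E, K p.2 p.1 ^ 2 ∂(μ.prod μ) = ∫ p : E × E, K p.1 p.2 ^ 2 ∂(μ.prod μ) :=
    integral_prod_swap (fun p : E × E => K p.1 p.2 ^ 2)
  have hle : ∫ p : E × E, S p.1 p.2 ^ 2 ∂(μ.prod μ)
      ≤ ∫ p : E × E, (2⁻¹ * K p.1 p.2 ^ 2 + 2⁻¹ * K p.2 p.1 ^ 2) ∂(μ.prod μ) := by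
    refine integral_mono (hoff S) (((hoff K).const_mul _).add (hflip.const_mul _))
      fun p => ?_
    simp only [hS]
    nlinarith [sq_nonneg (K p.1 p.2 - K p.2 p.1)]
  rw [integral_add ((hoff K).const_mul _) (hflip.const_mul _), integral_const_mul,
    integral_const_mul, hswap] at hle
  linarith

end Gaussian

theorem proposition3p4
    {H E Ω : Type*}
    [NormedAddCommGroup H] [InnerProductSpace ℝ H] [CompleteSpace H]
    [NormedAddCommGroup E] [NormedSpace ℝ E] [CompleteSpace E]
    [TopologicalSpace.SeparableSpace E] [MeasurableSpace E] [BorelSpace E]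
    [MeasurableSpace Ω] (P : Measure Ω) [IsProbabilityMeasure P]
    (ι : H →L[ℝ] E) (μ : Measure E) (hμ : IsAbstractWienerSpace ι μ)
    (B B' : Ω → E) (hB : HasLaw B μ P) (hB' : HasLaw B' μ P) (hindep : IndepFun B B' P)
    (K : ℝ → E →L[ℝ] E →L[ℝ] ℝ) (Kt : Ω → ℝ)
    (hK : TendstoInL2 P (fun δ ω => K δ (B ω) (B' ω)) Kt) :
    (∀ δ, Integrable (fun ω => K δ (B ω) (B ω)) P) ∧
    ∃ Klim : Ω → ℝ,
      TendstoInL2 P (fun δ ω => K δ (B ω) (B ω) - ∫ ω', K δ (B ω') (B ω') ∂P) Klim ∧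
      (∀ L : ℝ → E →L[ℝ] E →L[ℝ] ℝ,
        TendstoInL2 P (fun δ ω => L δ (B ω) (B' ω)) Kt →
        TendstoInL2 P (fun δ ω => L δ (B ω) (B ω) - ∫ ω', L δ (B ω') (B ω') ∂P) Klim) ∧
      ∫ ω, Klim ω ^ 2 ∂P ≤ 2 * ∫ ω, Kt ω ^ 2 ∂P := by
  have : SecondCountableTopology E := UniformSpace.secondCountable_of_separable E
  have := hμ.isGaussian
  have hid : MemLp id 4 μ := IsGaussian.memLp_id μ 4 (by simp)
  have hB4 : MemLp B 4 P := (hB.map_eq ▸ hid).comp_of_map hB.aemeasurable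
  have hB'4 : MemLp B' 4 P := (hB'.map_eq ▸ hid).comp_of_map hB'.aemeasurable
  have hlaw := hindep.hasLaw_prod hB hB'
  have hdiag (T : E →L[ℝ] E →L[ℝ] ℝ) : MemLp (fun ω => T (B ω) (B ω)) 2 P :=
    memLp_two_bilin_comp hB4 hB4 T
  have hdiag_int (T : E →L[ℝ] E →L[ℝ] ℝ) : Integrable (fun ω => T (B ω) (B ω)) P :=
    (hdiag T).integrable (by norm_num)
  have hcent (T : E →L[ℝ] E →L[ℝ] ℝ) :
      MemLp (fun ω => T (B ω) (B ω) - ∫ ω', T (B ω') (B ω') ∂P) 2 P :=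
    (hdiag T).sub (memLp_const _)
  have hoff (T : E →L[ℝ] E →L[ℝ] ℝ) : MemLp (fun ω => T (B ω) (B' ω)) 2 P :=
    memLp_two_bilin_comp hB4 hB'4 T
  have hle (T : E →L[ℝ] E →L[ℝ] ℝ) : ‖(hcent T).toLp _‖ ≤ √2 * ‖(hoff T).toLp _‖ := by
    refine le_of_sq_le_sq ?_ (by positivity)
    rw [mul_pow, Real.sq_sqrt (by norm_num), norm_toLp_two_sq, norm_toLp_two_sq,
      ← variance_eq_integral (hdiag T).aemeasurable]
    have hvar : Var[fun ω => T (B ω) (B ω); P] = Var[fun x => T x x; μ] := by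
      rw [← hB.map_eq, variance_map (Continuous.aemeasurable (by fun_prop)) hB.aemeasurable]
      rfl
    have hsq : ∫ ω, T (B ω) (B' ω) ^ 2 ∂P = ∫ p : E × E, T p.1 p.2 ^ 2 ∂(μ.prod μ) :=
      hlaw.integral_comp (f := fun p : E × E => T p.1 p.2 ^ 2)
        (Continuous.aestronglyMeasurable (by fun_prop))
    rw [hvar, hsq]
    exact variance_diag_le hμ.centred T
  have hsub (T U : E →L[ℝ] E →L[ℝ] ℝ) : ‖(hcent T).toLp _ - (hcent U).toLp _‖
      ≤ √2 * ‖(hoff T).toLp _ - (hoff U).toLp _‖ := by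
    -- Centring is linear in the form, so the norm bound for `T - U` is the Lipschitz bound.
    convert hle (T - U) using 2
    · rw [← MemLp.toLp_sub]
      congr 1
      ext ω
      simp only [Pi.sub_apply, sub_apply, integral_sub (hdiag_int T) (hdiag_int U)]
      ring
    · rw [← MemLp.toLp_sub]
      rfl
  have hKt := hK.2.1
  obtain ⟨a, ha, huniq, hnorm⟩ := exists_tendsto_of_norm_sub_le hsub hle
    ((tendstoInL2_iff (fun δ => hoff (K δ)) hKt).1 hK)
  have hconv (L : ℝ → E →L[ℝ] E →L[ℝ] ℝ)
      (h : Tendsto (fun δ => (hcent (L δ)).toLp _) (𝓝[>] (0 : ℝ)) (𝓝 a)) :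
      TendstoInL2 P (fun δ ω => L δ (B ω) (B ω) - ∫ ω', L δ (B ω') (B ω') ∂P) a := by
    rw [tendstoInL2_iff (fun δ => hcent (L δ)) (Lp.memLp a), Lp.toLp_coeFn]
    exact h
  refine ⟨fun δ => hdiag_int (K δ), a, hconv K ha, fun L hL => hconv L (huniq L
    ((tendstoInL2_iff (fun δ => hoff (L δ)) hKt).1 hL)), ?_⟩
  have hsq := pow_le_pow_left₀ (norm_nonneg a) hnorm 2
  rw [mul_pow, Real.sq_sqrt (by norm_num), norm_toLp_two_sq hKt] at hsq
  rwa [← norm_toLp_two_sq (Lp.memLp a), Lp.toLp_coeFn]
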